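/- Let $\mathbf{p} = 012102101021012101021012\cdots$ be the infinite word over the alphabet $\{0,1,2\}$ that is the unique fixed point of the morphism $h$ given by $0 \mapsto 01$, $1 \mapsto 21$, $2 \mapsto 0$. For $n \geq 0$ let $\rho^{\mathrm{ab}}_{\mathbf{p}}(n)$ denote the abelian complexity of $\mathbf{p}$, that is, the number of factors (contiguous blocks) of $\mathbf{p}$ of length $n$, where two factors are counted as the same if they are permutations of each other. Then $\rho^{\mathrm{ab}}_{\mathbf{p}}(n) \in \{3,4,5,6,7\}$ for every $n \geq 1$, and for each $k \in \{3,4,5,6,7\}$ there are infinitely many $n \geq 1$ with $\rho^{\mathrm{ab}}_{\mathbf{p}}(n) = k$. -/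

import Mathlib

namespace PWord

/-- The factor of length `n` of the infinite word `x` that starts at position `i`. -/
def factorAt {α : Type*} (x : ℕ → α) (i n : ℕ) : List α :=
  (List.range n).map fun j => x (i + j)

/-- The set of all factors of length `n` of the infinite word `x`. -/
def factors {α : Type*} (x : ℕ → α) (n : ℕ) : Set (List α) :=
  {w | ∃ i, w = factorAt x i n}

/-- The abelian complexity of an infinite word over a finite alphabet: the number of factors of
length `n`, where two factors that are permutations of each other are counted as the same.
(`Multiset α` is the quotient of `List α` by permutation.) -/
noncomputable def abelianComplexity {α : Type*} [Finite α] (x : ℕ → α) (n : ℕ) : ℕ :=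
  ((fun w : List α => (w : Multiset α)) '' factors x n).ncard

/-- The map `0 → 01`, `1 → 21`, `2 → 0` on letters. -/
def h : Fin 3 → List (Fin 3)
  | 0 => [0, 1]
  | 1 => [2, 1]
  | 2 => [0]

/-- The morphism of finite words induced by `h`. -/
def morph (w : List (Fin 3)) : List (Fin 3) := w.flatMap h

/-- The `k`-fold image of the word `0` under the morphism. -/
def iter (k : ℕ) : List (Fin 3) := morph^[k] [0]

/-- The infinite word `012102101021012101021012⋯`, the limit of the words `iter k`:
each of them is a prefix of the next, and `iter n` has more than `n` letters. It is the
unique fixed point of the morphism, see `isFixedPoint_iff` below. -/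
def p (n : ℕ) : Fin 3 := (iter n).getD n 0

/-- The infinite word `x` is a fixed point of the (nonerasing) morphism: the image of every
prefix of `x` is a prefix of `x`. -/
def IsFixedPoint (x : ℕ → Fin 3) : Prop :=
  ∀ n, morph (factorAt x 0 n) = factorAt x 0 (morph (factorAt x 0 n)).length

theorem morph_prefix {u v : List (Fin 3)} (huv : u <+: v) : morph u <+: morph v := by
  obtain ⟨t, rfl⟩ := huv
  exact ⟨morph t, by simp [morph]⟩

theorem iter_succ (k : ℕ) : iter (k + 1) = morph (iter k) := by
  simp only [iter, Function.iterate_succ_apply']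

theorem iter_prefix_succ (k : ℕ) : iter k <+: iter (k + 1) := by
  induction k with
  | zero => exact ⟨[1], rfl⟩
  | succ k ih => rw [iter_succ k, iter_succ (k + 1)]; exact morph_prefix ih

theorem iter_prefix {k l : ℕ} (hkl : k ≤ l) : iter k <+: iter l := by
  induction l, hkl using Nat.le_induction with
  | base => exact List.prefix_refl _
  | succ l _ ih => exact ih.trans (iter_prefix_succ l)

theorem length_le_morph (w : List (Fin 3)) : w.length ≤ (morph w).length := by
  induction w with
  | nil => simp
  | cons a w ih =>
    have ha : 1 ≤ (h a).length := by fin_cases a <;> simp [h]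
    simp only [morph, List.flatMap_cons, List.length_append, List.length_cons] at *
    omega

theorem lt_length_iter (k : ℕ) : k < (iter k).length := by
  induction k with
  | zero => simp [iter]
  | succ k ih =>
    obtain ⟨t, ht⟩ := iter_prefix (Nat.zero_le k)
    have h0 : iter 0 = [0] := rfl
    rw [h0] at ht
    have := length_le_morph t
    rw [iter_succ]
    rw [← ht] at ih ⊢
    simp only [morph, h, List.flatMap_append, List.flatMap_cons, List.flatMap_nil,
      List.length_append, List.length_cons, List.length_nil] at *
    omega

theorem iter_getElem (k i : ℕ) (hi : i < (iter k).length) : (iter k)[i] = p i := by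
  have hi' := lt_length_iter i
  unfold p
  rw [List.getD_eq_getElem _ _ hi']
  rcases le_total k i with hki | hik
  · exact (iter_prefix hki).getElem hi
  · exact ((iter_prefix hik).getElem hi').symm

theorem prefix_iter_eq {k : ℕ} {w : List (Fin 3)} (hw : w <+: iter k) :
    w = factorAt p 0 w.length := by
  apply List.ext_getElem
  · simp [factorAt]
  · intro i h1 h2
    rw [hw.getElem h1, iter_getElem]
    simp [factorAt]

theorem factorAt_prefix_iter (n : ℕ) : factorAt p 0 n <+: iter n := by
  have h1 := prefix_iter_eq ((iter n).take_prefix n)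
  have h2 : ((iter n).take n).length = n := by
    have := lt_length_iter n
    simp; omega
  rw [h2] at h1
  rw [← h1]
  exact List.take_prefix _ _

theorem isFixedPoint_p : IsFixedPoint p := by
  intro n
  apply prefix_iter_eq (k := n + 1)
  rw [iter_succ]
  exact morph_prefix (factorAt_prefix_iter n)

/-- `p` is the only fixed point of the morphism. -/
theorem isFixedPoint_iff (x : ℕ → Fin 3) : IsFixedPoint x ↔ x = p := by
  constructor
  · intro hx
    have h0 : x 0 = 0 := by
      have h1 := hx 1
      generalize hx0 : x 0 = a at *
      fin_cases a
      · rfl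
      · simp [factorAt, morph, h, List.range_succ, hx0] at h1
      · simp [factorAt, morph, h, List.range_succ, hx0] at h1
    have key : ∀ k, iter k = factorAt x 0 (iter k).length := by
      intro k
      induction k with
      | zero => simp [iter, factorAt, h0]
      | succ k ih =>
        have := hx (iter k).length
        rw [← ih] at this
        rw [iter_succ]
        exact this
    funext n
    have hn := lt_length_iter n
    rw [← iter_getElem n n hn]
    have h2 := List.getElem_of_eq (key n) hn
    rw [h2]
    simp [factorAt]
  · rintro rfl
    exact isFixedPoint_p

end PWord

namespace PWord

/-! Write P(n) for the Parikh vector of the prefix of length n. The abelian complexity at n is the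
number of vectors P(j) - P(i) - P(n) with j - i = n. For positions m, i, j record the letters at i
and j and the vector P(j) - P(i) - P(m). If m', i', j' lie in the images under the morphism of the
letters at m, i, j, then the new record depends only on the old one, the letter at m and the three
offsets. Hence the set of all records at m' is determined by the set at m, the letter at m and the
offset of m': this is a deterministic automaton.

Images of different letters have different lengths, so a balanced triple (j - i = m) can descend
from an unbalanced one. The sets therefore keep all records with j - i - m in a small window, and a
check on the extreme records (`isSafe`) shows that nothing outside the window has descendants inside
it. No bound on the vectors is proved beforehand: a search finds that only finitely many states are
reachable from position 1. Counting balanced vectors in each gives values from 3 to 7, and for each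
value a cycle through a state with that count is visited at arbitrarily large positions.

The kernel evaluates the search (`verify_tables`). The lemmas that give it meaning are
`IsSoundAt.combine` and `IsCompleteAt.combine` (a transition yields exactly the realized records),
`isStateAt_zero` (the start), `explore_spec` (closure of the reachable set) and
`IsStateAt.abelianComplexity_eq`. -/

/-! ### Configurations and their descent under the morphism. -/

/-- Integer vectors indexed by the three letters. -/
abbrev Vec := ℤ × ℤ × ℤ

/-- The sum of the coordinates. -/
def total (v : Vec) : ℤ := v.1 + v.2.1 + v.2.2

/-- The Parikh vector of a letter. -/
def unit : Fin 3 → Vec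
  | 0 => (1, 0, 0)
  | 1 => (0, 1, 0)
  | 2 => (0, 0, 1)

/-- The action of the morphism on Parikh vectors. -/
def incidence (v : Vec) : Vec := (v.1 + v.2.2, v.1 + v.2.1, v.2.1)

/-- The letters of `h a`, each with the Parikh vector of the part of `h a` before it. -/
def expansion : Fin 3 → List (Fin 3 × Vec)
  | 0 => [(0, (0, 0, 0)), (1, (1, 0, 0))]
  | 1 => [(2, (0, 0, 0)), (1, (0, 0, 1))]
  | 2 => [(0, (0, 0, 0))]

/-- Two letters and a vector, see `configAt`. -/
abbrev Config := Fin 3 × Fin 3 × Vec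

/-- The vectors kept by the computation. -/
def inWindow (v : Vec) : Bool := decide (-2 ≤ total v) && decide (total v ≤ 3)

/-- The configurations at position `n'` that descend from the configuration `t` at position `n`,
if the prefix of length `n'` is the image of the prefix of length `n` followed by a word with
Parikh vector `g`. -/
def children (g : Vec) (t : Config) : List Config :=
  (expansion t.1).flatMap fun y =>
    ((expansion t.2.1).map fun z => (y.1, z.1, incidence t.2.2 - g - y.2 + z.2)).filter
      fun u => inWindow u.2.2

/-- An injective numbering of the configurations with a small vector; the others get `1620`. -/
def code (t : Config) : ℕ :=
  bif decide (-2 ≤ t.2.2.1) && decide (t.2.2.1 ≤ 2) && decide (-2 ≤ t.2.2.2.1) &&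
    decide (t.2.2.2.1 ≤ 3) && inWindow t.2.2 then
    (t.2.2.1 + 2).toNat + 5 * ((t.2.2.2.1 + 2).toNat + 6 * ((total t.2.2 + 2).toNat +
      6 * (t.2.1.val + 3 * t.1.val)))
  else 1620

/-- The configuration with the code `k`. -/
def decode (k : ℕ) : Config :=
  let x : ℤ := (k % 5 : ℕ) - 2
  let y : ℤ := (k / 5 % 6 : ℕ) - 2
  let q : ℤ := (k / 30 % 6 : ℕ) - 2
  (Fin.ofNat 3 (k / 540), Fin.ofNat 3 (k / 180), (x, y, q - x - y))

/-! ### Computation of the configurations and their transition tables. -/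

/-- Application with the argument evaluated first by the kernel. -/
def force {α : Type} (n : ℕ) (f : ℕ → α) : α :=
  match n with
  | 0 => f 0
  | k + 1 => f (Nat.succ k)

def forceList {α : Type} : List ℕ → (List ℕ → α) → α
  | [], f => f []
  | k :: l, f => force k fun k => forceList l fun l => f (k :: l)

def forcePairs {α : Type} : List (ℕ × ℕ) → (List (ℕ × ℕ) → α) → α
  | [], f => f []
  | x :: l, f => force x.1 fun k => force x.2 fun m => forcePairs l fun l => f ((k, m) :: l)

/-- Depth-first search through the configurations that descend from those in a list. The bitmasks
record the pairs of a letter and a configuration, and the configurations, that have been met. -/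
def grow : ℕ → List (Fin 3 × Config) → ℕ → ℕ → List Config → List Config
  | 0, _, _, _, acc => acc
  | _ + 1, [], _, _, acc => acc
  | n + 1, (c, t) :: todo, seen, seenConfig, acc =>
    force (code t) fun k =>
    bif Nat.testBit seen (k + 1621 * c.val) then grow n todo seen seenConfig acc
    else
      let todo' := ((expansion c).flatMap fun x =>
        (children x.2 (decode k)).map fun u => (x.1, u)) ++ todo
      force (seen ||| (1 <<< (k + 1621 * c.val))) fun seen' =>
      bif Nat.testBit seenConfig k then grow n todo' seen' seenConfig acc
      else force (seenConfig ||| (1 <<< k)) fun seenConfig' =>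
        grow n todo' seen' seenConfig' (decode k :: acc)

/-- The configurations that occur. -/
@[irreducible] def configs : List Config := grow 5000 [(0, (0, 0, (0, 0, 0)))] 0 0 []

/-- A set of configurations as a bitmask. -/
def mask (l : List Config) : ℕ := l.foldr (fun t m => 2 ^ code t ||| m) 0

/-- For each configuration its code and the set of its children. -/
def table (g : Vec) : List (ℕ × ℕ) := configs.map fun t => (code t, mask (children g t))

/-- The union of the sets in a table whose codes belong to the set `b`. -/
def combine (l : List (ℕ × ℕ)) (b : ℕ) : ℕ :=
  List.rec 0 (fun x _ r => Nat.lor (Nat.mul (Nat.land (Nat.shiftRight b x.1) 1) x.2) r) l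

/-- If the vector of `t` has the largest or smallest sum in the window, then moving its second
position further out leads to configurations all of whose images lie outside the window. -/
def isSafe (c : Fin 3) (t : Config) : Bool :=
  (decide (total t.2.2 ≠ 3) || (expansion c).all fun x => (expansion t.1).all fun y =>
    decide (3 < total (incidence (t.2.2 + unit t.2.1)) - total x.2 - total y.2)) &&
  (decide (total t.2.2 ≠ -2) || decide (total (incidence t.2.2) ≤ -2))

def unsafeMask (c : Fin 3) : ℕ := mask (configs.filter fun t => !isSafe c t)

def balancedVecs : List Vec :=
  ((configs.map fun t => t.2.2).filter fun v => decide (total v = 0)).dedup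

def balancedMasks : List ℕ :=
  balancedVecs.map fun v => mask (configs.filter fun t => decide (t.2.2 = v))

/-! ### The automaton of states and its exploration. -/

/-- The data used by the search through the states. -/
structure Tables where
  zero : List (ℕ × ℕ)
  left : List (ℕ × ℕ)
  right : List (ℕ × ℕ)
  full : ℕ
  risky : List ℕ
  balanced : List ℕ

def tables : Tables where
  zero := table (0, 0, 0)
  left := table (1, 0, 0)
  right := table (0, 0, 1)
  full := mask configs
  risky := [unsafeMask 0, unsafeMask 1, unsafeMask 2]
  balanced := balancedMasks

namespace Tables

def force {α : Type} (T : Tables) (f : Tables → α) : α :=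
  forcePairs T.zero fun z => forcePairs T.left fun l => forcePairs T.right fun r =>
  PWord.force T.full fun k => forceList T.risky fun s => forceList T.balanced fun b =>
  f ⟨z, l, r, k, s, b⟩

/-- Only three offset vectors occur in `expansion`, so three tables suffice. -/
def edges (T : Tables) : Fin 3 → List (Fin 3 × List (ℕ × ℕ))
  | 0 => [(0, T.zero), (1, T.left)]
  | 1 => [(2, T.zero), (1, T.right)]
  | 2 => [(0, T.zero)]

end Tables

/-- A letter and a set of configurations. -/
abbrev State := Fin 3 × ℕ

def successors (T : Tables) (s : State) : List State :=
  (T.edges s.1).map fun x => (x.1, combine x.2 s.2)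

def isClosedState (T : Tables) (s : State) : Bool :=
  Nat.beq (Nat.lor s.2 T.full) T.full && Nat.beq (Nat.land s.2 (T.risky.getD s.1 0)) 0

/-- The number of vectors with sum zero in a set of configurations. -/
def numBalanced (T : Tables) (b : ℕ) : ℕ :=
  T.balanced.countP fun m => !Nat.beq (Nat.land b m) 0

def isGoodState (T : Tables) (s : State) : Bool :=
  isClosedState T s && force (numBalanced T s.2) fun k => Nat.ble 3 k && Nat.ble k 7

inductive SearchTree
  | leaf
  | node (l : SearchTree) (k : ℕ) (r : SearchTree)

namespace SearchTree

def mem (k : ℕ) : SearchTree → Bool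
  | leaf => false
  | node l m r => bif Nat.beq k m then true else bif Nat.ble k m then mem k l else mem k r

def insert (k : ℕ) : SearchTree → SearchTree
  | leaf => node leaf k leaf
  | node l m r => bif Nat.ble k m then node (insert k l) m r else node l m (insert k r)

end SearchTree

/-- Depth-first search that checks that all states reachable from those in a list are good. -/
def explore (T : Tables) : ℕ → List State → SearchTree → Bool
  | 0, _, _ => false
  | _ + 1, [], _ => true
  | n + 1, (c, b') :: todo, seen =>
    force b' fun b =>
    force (3 * b + c) fun k =>
    bif seen.mem k then explore T n todo seen
    else bif isGoodState T (c, b) then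
      explore T n (successors T (c, b) ++ todo) (seen.insert k)
    else false

/-- Position 0 lies in its own image with offset zero, so the set there should be a fixed point of
`combine T.zero`. That the iteration has stabilized is checked in `verify`. -/
def iterateZero (T : Tables) : ℕ → ℕ → ℕ
  | 0, b => b
  | n + 1, b => force (combine T.zero b) fun b' => iterateZero T n b'

/-- The set of configurations at position zero. -/
def initialSet (T : Tables) : ℕ := iterateZero T 5 (2 ^ code (0, 0, 0, 0, 0))

/-- The state at position one. -/
def initialState (T : Tables) : State := (1, combine T.left (initialSet T))

/-- Follow a path through the states; `none` if a step does not exist. -/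
def run (T : Tables) : List ℕ → State → Option State
  | [], s => some s
  | k :: l, s => force s.2 fun b => (successors T (s.1, b))[k]?.bind fun t => run T l t

/-- The path `u` from the initial state leads to a cycle `w` at a state with `k` balanced
vectors. -/
def isRecurrent (T : Tables) (k : ℕ) (u w : List ℕ) : Bool :=
  match run T u (initialState T) with
  | none => false
  | some (c, b') => force b' fun b => Nat.beq (numBalanced T b) k &&
    match run T w (c, b) with
    | none => false
    | some (d, b'') => decide (c = d) && Nat.beq b b''

/-- The check of the set at position zero, the search from position one, and for each value a cycle
on which it recurs. -/
def verify (T : Tables) : Bool :=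
  Nat.blt T.full (2 ^ 1620) &&
  (force (initialSet T) fun b => Nat.beq (combine T.zero b) b && isClosedState T (0, b) &&
    [(0, 0, 0, 0, 0), (0, 1, 1, 0, 0), (0, 2, 1, 1, 0), (0, 1, 1, 1, 1)].all
      fun t => b.testBit (code t)) &&
  explore T 2000 [initialState T] .leaf &&
  isRecurrent T 3 [1, 1, 1, 0, 0, 0] [0, 0, 1, 1, 1, 1, 0, 0, 0] &&
  isRecurrent T 4 [0, 0, 1, 0, 0, 1] [0, 0, 1] &&
  isRecurrent T 5 [0, 0, 1, 0, 0] [1, 0, 0] &&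
  isRecurrent T 6 [1, 0, 0, 1, 0, 0, 0, 0, 0] [1, 0, 0, 0, 0, 0] &&
  isRecurrent T 7 [1, 0, 0, 0, 0, 0, 0, 0, 0, 0, 0, 0, 0, 0, 0] [0]

/-- The only large computation. The tables are reduced to numerals once, before `verify` uses them.
-/
theorem verify_tables : tables.force verify = true := by decide +kernel

/-! ### Parikh vectors and positions inside images of letters. -/

/-- The Parikh vector of the prefix of length `n`. -/
def parikh : ℕ → Vec
  | 0 => 0
  | n + 1 => parikh n + unit (p n)

theorem total_add (u v : Vec) : total (u + v) = total u + total v := by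
  simp only [total, Prod.fst_add, Prod.snd_add]; ring

theorem total_sub (u v : Vec) : total (u - v) = total u - total v := by
  simp only [total, Prod.fst_sub, Prod.snd_sub]; ring

theorem incidence_add (u v : Vec) : incidence (u + v) = incidence u + incidence v := by
  ext <;> simp only [incidence, Prod.fst_add, Prod.snd_add] <;> ring

theorem incidence_sub (u v : Vec) : incidence (u - v) = incidence u - incidence v := by
  ext <;> simp only [incidence, Prod.fst_sub, Prod.snd_sub] <;> ring

theorem total_unit (a : Fin 3) : total (unit a) = 1 := by fin_cases a <;> rfl

theorem total_parikh (n : ℕ) : total (parikh n) = n := by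
  induction n with
  | zero => rfl
  | succ n ih => rw [parikh, total_add, ih, total_unit]; push_cast; rfl

/-- The length of the image of the prefix of length `n`. -/
def imageLength (n : ℕ) : ℕ := (morph (factorAt p 0 n)).length

theorem morph_factorAt_succ (n : ℕ) :
    morph (factorAt p 0 (n + 1)) = morph (factorAt p 0 n) ++ h (p n) := by
  simp [morph, factorAt, List.range_succ]

theorem imageLength_succ (n : ℕ) : imageLength (n + 1) = imageLength n + (h (p n)).length := by
  rw [imageLength, morph_factorAt_succ, List.length_append, imageLength]

theorem p_imageLength_add (n k : ℕ) (hk : k < (h (p n)).length) :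
    p (imageLength n + k) = (h (p n))[k] := by
  have h1 := isFixedPoint_p (n + 1)
  have h2 : imageLength n + k < (morph (factorAt p 0 (n + 1))).length := by
    rw [morph_factorAt_succ, List.length_append, imageLength]; omega
  have h3 := List.getElem_of_eq h1 h2
  rw [List.getElem_of_eq (morph_factorAt_succ n) h2] at h3
  rw [List.getElem_append_right (by simp [imageLength])] at h3
  simpa [factorAt, imageLength] using h3.symm

theorem parikh_imageLength (n : ℕ) : parikh (imageLength n) = incidence (parikh n) := by
  induction n with
  | zero => rfl
  | succ n ih =>
    have h0 := p_imageLength_add n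
    rw [imageLength_succ]
    rw [show parikh (n + 1) = parikh n + unit (p n) from rfl, incidence_add, ← ih]
    generalize p n = a at h0
    match a with
    | 0 =>
      have h1 := h0 0 (by simp [h])
      have h2 := h0 1 (by simp [h])
      simp only [h, add_zero] at h1 h2
      simp [h, parikh, h1, h2, unit, incidence, add_assoc]
    | 1 =>
      have h1 := h0 0 (by simp [h])
      have h2 := h0 1 (by simp [h])
      simp only [h, add_zero] at h1 h2
      simp [h, parikh, h1, h2, unit, incidence, add_assoc]
    | 2 =>
      have h1 := h0 0 (by simp [h])
      simp only [h, add_zero] at h1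
      simp [h, parikh, h1, unit, incidence]

/-- The letter at position `k` is the letter of the image of the letter at position `n` given by
`x`. -/
def IsImage (n k : ℕ) (x : Fin 3 × Vec) : Prop :=
  x ∈ expansion (p n) ∧ p k = x.1 ∧ parikh k = incidence (parikh n) + x.2

theorem length_h_pos (a : Fin 3) : 0 < (h a).length := by fin_cases a <;> simp [h]

theorem length_expansion (a : Fin 3) : (expansion a).length = (h a).length := by
  fin_cases a <;> rfl

theorem isImage_getElem (n k : ℕ) (hk : k < (expansion (p n)).length) :
    IsImage n (imageLength n + k) (expansion (p n))[k] := by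
  refine ⟨List.getElem_mem hk, ?_⟩
  have h0 := p_imageLength_add n
  have h3 := parikh_imageLength n
  generalize p n = a at h0 hk
  match a with
  | 0 =>
    have h1 := h0 0 (by simp [h])
    have h2 := h0 1 (by simp [h])
    simp only [h, add_zero] at h1 h2
    simp only [expansion, List.length_cons, List.length_nil] at hk
    interval_cases k
    · exact ⟨h1, h3.trans (add_zero _).symm⟩
    · exact ⟨h2, by simp [expansion, parikh, h3, h1, unit]⟩
  | 1 =>
    have h1 := h0 0 (by simp [h])
    have h2 := h0 1 (by simp [h])
    simp only [h, add_zero] at h1 h2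
    simp only [expansion, List.length_cons, List.length_nil] at hk
    interval_cases k
    · exact ⟨h1, h3.trans (add_zero _).symm⟩
    · exact ⟨h2, by simp [expansion, parikh, h3, h1, unit]⟩
  | 2 =>
    have h1 := h0 0 (by simp [h])
    simp only [h, add_zero] at h1
    simp only [expansion, List.length_cons, List.length_nil] at hk
    interval_cases k
    exact ⟨h1, h3.trans (add_zero _).symm⟩

theorem exists_isImage_of_mem {n : ℕ} {x : Fin 3 × Vec} (hx : x ∈ expansion (p n)) :
    ∃ k, IsImage n k x := by
  obtain ⟨k, hk, rfl⟩ := List.mem_iff_getElem.mp hx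
  exact ⟨_, isImage_getElem n k hk⟩

/-- Strict because the first letter of the word has an image of length two. This makes descent
strictly increasing on positive positions, which serves both the inductions on positions and the
infinitude of recurrences. -/
theorem lt_imageLength {n : ℕ} (hn : 0 < n) : n < imageLength n := by
  induction n, hn using Nat.le_induction with
  | base => decide
  | succ n _ ih =>
    have := length_h_pos (p n)
    rw [imageLength_succ]; omega

theorem total_nonneg_of_mem {a : Fin 3} {x : Fin 3 × Vec} (hx : x ∈ expansion a) :
    0 ≤ total x.2 := by
  revert x; revert a; decide

theorem total_lt_of_mem {a : Fin 3} {x : Fin 3 × Vec} (hx : x ∈ expansion a) :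
    total x.2 < total (incidence (unit a)) := by
  revert x; revert a; decide

theorem IsImage.imageLength_le {n k : ℕ} {x : Fin 3 × Vec} (hx : IsImage n k x) :
    imageLength n ≤ k := by
  have h1 := congrArg total hx.2.2
  rw [← parikh_imageLength, total_add, total_parikh, total_parikh] at h1
  have := total_nonneg_of_mem hx.1
  omega

theorem IsImage.lt {n k : ℕ} {x : Fin 3 × Vec} (hx : IsImage n k x) (hn : 0 < n) : n < k :=
  (lt_imageLength hn).trans_le hx.imageLength_le

theorem exists_isImage (k : ℕ) : ∃ n x, IsImage n k x := by
  have key : ∀ n, imageLength n ≤ k ∨ ∃ n x, IsImage n k x := by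
    intro n
    induction n with
    | zero => exact Or.inl (Nat.zero_le _)
    | succ n ih =>
      rcases ih with ih | ih
      · rw [imageLength_succ]
        rcases le_or_gt (imageLength n + (h (p n)).length) k with hk | hk
        · exact Or.inl hk
        · have hx := isImage_getElem n (k - imageLength n) (by rw [length_expansion]; omega)
          rw [Nat.add_sub_cancel' ih] at hx
          exact Or.inr ⟨n, _, hx⟩
      · exact Or.inr ih
  refine (key (k + 1)).resolve_left fun hk => ?_
  have := lt_imageLength (n := k + 1) k.succ_pos
  omega

theorem IsImage.lt_of_pos {n k : ℕ} {x : Fin 3 × Vec} (hx : IsImage n k x) (hk : 0 < k) :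
    n < k := by
  rcases n.eq_zero_or_pos with rfl | hn
  · exact hk
  · exact hx.lt hn

/-! ### Meaning of the bitmask operations. -/

theorem force_eq {α : Type} (n : ℕ) (f : ℕ → α) : force n f = f n := by
  cases n <;> rfl

theorem forceList_eq {α : Type} (l : List ℕ) (f : List ℕ → α) : forceList l f = f l := by
  induction l generalizing f with
  | nil => rfl
  | cons k l ih => rw [forceList, force_eq, ih]

theorem forcePairs_eq {α : Type} (l : List (ℕ × ℕ)) (f : List (ℕ × ℕ) → α) :
    forcePairs l f = f l := by
  induction l generalizing f with
  | nil => rfl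
  | cons k l ih => rw [forcePairs, force_eq, force_eq, ih]

theorem Tables.force_eq {α : Type} (T : Tables) (f : Tables → α) : T.force f = f T := by
  simp only [Tables.force, forcePairs_eq, forceList_eq, PWord.force_eq]

theorem Tables.edges_tables (c : Fin 3) :
    tables.edges c = (expansion c).map fun x => (x.1, table x.2) := by
  fin_cases c <;> rfl

theorem successors_tables (s : State) :
    successors tables s = (expansion s.1).map fun x => (x.1, combine (table x.2) s.2) := by
  rw [successors, Tables.edges_tables, List.map_map]
  rfl

theorem testBit_mask (l : List Config) (k : ℕ) :
    (mask l).testBit k = true ↔ ∃ t ∈ l, code t = k := by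
  induction l with
  | nil => simp [mask]
  | cons t l ih =>
    have hm : mask (t :: l) = 2 ^ code t ||| mask l := rfl
    rw [hm, Nat.testBit_or, Bool.or_eq_true, ih, Nat.testBit_two_pow]
    simp

theorem testBit_combine (l : List (ℕ × ℕ)) (b k : ℕ) :
    (combine l b).testBit k = true ↔ ∃ x ∈ l, b.testBit x.1 = true ∧ x.2.testBit k = true := by
  induction l with
  | nil => simp [combine]
  | cons x l ih =>
    have hm : combine (x :: l) b = ((b >>> x.1) &&& 1) * x.2 ||| combine l b := rfl
    have hb : (b >>> x.1) &&& 1 = (b.testBit x.1).toNat := by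
      rw [Nat.and_one_is_mod, Nat.toNat_testBit, Nat.shiftRight_eq_div_pow]
    rw [hm, hb, Nat.testBit_or, Bool.or_eq_true, ih]
    cases hx : b.testBit x.1 <;> simp [hx]

theorem land_eq_zero {a b k : ℕ} (hab : a &&& b = 0) (ha : a.testBit k = true) :
    ¬ b.testBit k = true := fun hb => by
  have := congrArg (Nat.testBit · k) hab
  simp [ha, hb] at this

theorem land_ne_zero (a b : ℕ) :
    a &&& b ≠ 0 ↔ ∃ k, a.testBit k = true ∧ b.testBit k = true := by
  constructor
  · intro hab
    obtain ⟨k, hk⟩ := Nat.exists_testBit_of_ne_zero hab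
    rw [Nat.testBit_and, Bool.and_eq_true] at hk
    exact ⟨k, hk⟩
  · rintro ⟨k, ha, hb⟩ hab
    exact land_eq_zero hab ha hb

theorem code_of_lt {t : Config} (ht : code t < 1620) :
    (-2 ≤ t.2.2.1 ∧ t.2.2.1 ≤ 2) ∧ (-2 ≤ t.2.2.2.1 ∧ t.2.2.2.1 ≤ 3) ∧
      (-2 ≤ total t.2.2 ∧ total t.2.2 ≤ 3) ∧
      code t = (t.2.2.1 + 2).toNat + 5 * ((t.2.2.2.1 + 2).toNat + 6 * ((total t.2.2 + 2).toNat +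
        6 * (t.2.1.val + 3 * t.1.val))) := by
  unfold code at ht ⊢
  rw [Bool.cond_eq_ite] at ht ⊢
  split_ifs at ht ⊢ with hc
  · simp only [Bool.and_eq_true, decide_eq_true_eq, inWindow] at hc
    obtain ⟨⟨⟨⟨h1, h2⟩, h3⟩, h4⟩, h5⟩ := hc
    exact ⟨⟨h1, h2⟩, ⟨h3, h4⟩, h5, rfl⟩
  · exact absurd ht (lt_irrefl _)

/-- Below 1620 = 5 * 6 * 6 * 9 the code is a mixed-radix expansion whose digits are the first two
coordinates, the total and the two letters; the third coordinate is recovered from the total. -/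
theorem code_injective {t u : Config} (htu : code t = code u) (ht : code t < 1620) : t = u := by
  obtain ⟨h1, h2, h3, h4⟩ := code_of_lt ht
  obtain ⟨h5, h6, h7, h8⟩ := code_of_lt (htu ▸ ht)
  rw [h4, h8] at htu
  obtain ⟨⟨a, ha⟩, ⟨b, hb⟩, x, y, z⟩ := t
  obtain ⟨⟨a', ha'⟩, ⟨b', hb'⟩, x', y', z'⟩ := u
  simp only [total] at *
  simp only [Prod.mk.injEq, Fin.mk.injEq]
  clear h4 h8 ht
  omega

/-- The set of configurations with the given bitmask. -/
def configsOf (b : ℕ) : Set Config := {t | t ∈ configs ∧ b.testBit (code t) = true}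

theorem testBit_combine_table (g : Vec) (b k : ℕ) :
    (combine (table g) b).testBit k = true ↔
      ∃ t ∈ configsOf b, ∃ u ∈ children g t, code u = k := by
  rw [testBit_combine, table]
  simp only [List.mem_map, configsOf, Set.mem_ofPred_eq]
  constructor
  · rintro ⟨_, ⟨t, ht, rfl⟩, h1, h2⟩
    exact ⟨t, ⟨ht, h1⟩, (testBit_mask _ _).mp h2⟩
  · rintro ⟨t, ⟨ht, h1⟩, h2⟩
    exact ⟨_, ⟨t, ht, rfl⟩, h1, (testBit_mask _ _).mpr h2⟩

theorem mem_children {g : Vec} {t u : Config} :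
    u ∈ children g t ↔ ∃ y ∈ expansion t.1, ∃ z ∈ expansion t.2.1,
      u = (y.1, z.1, incidence t.2.2 - g - y.2 + z.2) ∧ inWindow u.2.2 = true := by
  simp only [children, List.mem_flatMap, List.mem_filter, List.mem_map]
  constructor
  · rintro ⟨y, hy, ⟨z, hz, rfl⟩, hw⟩
    exact ⟨y, hy, z, hz, rfl, hw⟩
  · rintro ⟨y, hy, z, hz, rfl, hw⟩
    exact ⟨y, hy, ⟨z, hz, rfl⟩, hw⟩

/-! ### Transitions preserve soundness and completeness. -/

/-- The letters at the positions `i` and `j`, and the vector from `i` to `j` relative to the Parikh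
vector of the prefix of length `m`. -/
def configAt (m i j : ℕ) : Config := (p i, p j, parikh j - parikh i - parikh m)

def IsSoundAt (m b : ℕ) : Prop := ∀ t ∈ configsOf b, ∃ i j, t = configAt m i j

/-- Stated for a single `i` because at position 0 completeness is proved by induction on `i`. -/
def IsCompleteAt (m i b : ℕ) : Prop :=
  ∀ j, inWindow (configAt m i j).2.2 = true → configAt m i j ∈ configsOf b

theorem inWindow_iff (v : Vec) : inWindow v = true ↔ -2 ≤ total v ∧ total v ≤ 3 := by
  simp [inWindow]

theorem total_configAt (m i j : ℕ) : total (configAt m i j).2.2 = (j : ℤ) - i - m := by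
  rw [configAt, total_sub, total_sub, total_parikh, total_parikh, total_parikh]

theorem configAt_of_isImage {m m' i i' j j' : ℕ} {x y z : Fin 3 × Vec} (hx : IsImage m m' x)
    (hy : IsImage i i' y) (hz : IsImage j j' z) :
    configAt m' i' j' =
      (y.1, z.1, incidence (configAt m i j).2.2 - x.2 - y.2 + z.2) := by
  simp only [configAt, hx.2.2, hy.2.2, hz.2.2, hy.2.1, hz.2.1, incidence_sub]
  congr 2
  abel

-- Nothing is proved about how `grow` produces `configs`; this bound, read off from the computed
-- mask, is what makes codes identify its members.
set_option exponentiation.threshold 2000 in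
theorem code_lt_of_mem_configs (hfull : mask configs < 2 ^ 1620) {t : Config} (ht : t ∈ configs) :
    code t < 1620 := by
  have h1 : (mask configs).testBit (code t) = true := (testBit_mask _ _).mpr ⟨t, ht, rfl⟩
  by_contra! h2
  rw [Nat.testBit_lt_two_pow (hfull.trans_le (Nat.pow_le_pow_right two_pos h2))] at h1
  exact Bool.false_ne_true h1

/-- The positions in the images of the letters at `i` and `j` can be chosen independently, so every
child of a realized configuration is realized. -/
theorem IsSoundAt.combine {m m' b : ℕ} {x : Fin 3 × Vec} (hfull : mask configs < 2 ^ 1620)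
    (hb : IsSoundAt m b) (hx : IsImage m m' x) :
    IsSoundAt m' (combine (table x.2) b) := by
  rintro t' ⟨ht', hbit⟩
  obtain ⟨t, ht, u, hu, hcode⟩ := (testBit_combine_table _ _ _).mp hbit
  obtain rfl := code_injective hcode (hcode ▸ code_lt_of_mem_configs hfull ht')
  obtain ⟨i, j, rfl⟩ := hb t ht
  obtain ⟨y, hy, z, hz, hu, -⟩ := mem_children.mp hu
  obtain ⟨i', hi⟩ := exists_isImage_of_mem hy
  obtain ⟨j', hj⟩ := exists_isImage_of_mem hz
  exact ⟨i', j', by rw [configAt_of_isImage hx hi hj, hu]⟩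

theorem total_incidence_parikh_mono {i j : ℕ} (hij : i ≤ j) :
    total (incidence (parikh i)) ≤ total (incidence (parikh j)) := by
  induction j, hij using Nat.le_induction with
  | base => exact le_rfl
  | succ j _ ih =>
    rw [parikh, incidence_add, total_add]
    have : ∀ a, 0 ≤ total (incidence (unit a)) := by decide
    have := this (p j)
    omega

theorem total_incidence_parikh_succ (j : ℕ) : total (incidence (parikh (j + 1))) =
    total (incidence (parikh j)) + total (incidence (unit (p j))) := by
  rw [parikh, incidence_add, total_add]

theorem isClosedState_iff (c : Fin 3) (b : ℕ) : isClosedState tables (c, b) = true ↔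
    b ||| mask configs = mask configs ∧ b &&& unsafeMask c = 0 := by
  have : tables.risky.getD c 0 = unsafeMask c := by fin_cases c <;> rfl
  simp only [isClosedState, Bool.and_eq_true, Nat.beq_eq]
  rw [this]
  rfl

theorem isSafe_of_mem {c : Fin 3} {b : ℕ} (hb : b &&& unsafeMask c = 0) {t : Config}
    (ht : t ∈ configsOf b) : isSafe c t = true := by
  by_contra hs
  refine land_eq_zero hb ht.2 ((testBit_mask _ _).mpr ⟨t, ?_, rfl⟩)
  rw [List.mem_filter]
  exact ⟨ht.1, by simpa using hs⟩

/-- Each `j'` comes from some `j`. If `j` were outside the window seen from `m` and `i`, then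
monotonicity of image lengths, compared with the extreme position inside the window, would put `j'`
outside its own window; the safety check supplies the needed inequality. -/
theorem IsCompleteAt.combine {m m' i i' b : ℕ} {x y : Fin 3 × Vec}
    (hfull : mask configs < 2 ^ 1620) (hb : IsCompleteAt m i b) (hsafe : b &&& unsafeMask (p m) = 0)
    (hnext : PWord.combine (table x.2) b ||| mask configs = mask configs)
    (hx : IsImage m m' x) (hy : IsImage i i' y) :
    IsCompleteAt m' i' (PWord.combine (table x.2) b) := by
  intro j' hj'
  obtain ⟨j, z, hz⟩ := exists_isImage j'
  have hconf := configAt_of_isImage hx hy hz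
  have hzpos := total_nonneg_of_mem hz.1
  have hzlt := total_lt_of_mem hz.1
  have hxpos := total_nonneg_of_mem hx.1
  have hypos := total_nonneg_of_mem hy.1
  have htotal : total (configAt m' i' j').2.2 = total (incidence (parikh j)) -
      total (incidence (parikh i)) - total (incidence (parikh m)) - total x.2 - total y.2 +
      total z.2 := by
    rw [hconf]
    simp only [configAt, incidence_sub, total_sub, total_add]
  have hwin := (inWindow_iff _).mp hj'
  -- If `j` is too small, `j'` lies before the end of the image of position `j`, hence before the
  -- image of position `i + m - 2`, where the total is already at most -2.
  have hlow : i + m ≤ j + 2 := by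
    by_contra! hj
    have hmem := hb (i + m - 2) (by rw [inWindow_iff, total_configAt]; omega)
    have hs := isSafe_of_mem hsafe hmem
    rw [isSafe, Bool.and_eq_true, total_configAt] at hs
    have hs2 : total (incidence (configAt m i (i + m - 2)).2.2) ≤ -2 := by
      have := hs.2
      simp only [Bool.or_eq_true, decide_eq_true_eq] at this
      omega
    simp only [configAt, incidence_sub, total_sub] at hs2
    have h1 := total_incidence_parikh_mono (show j + 1 ≤ i + m - 2 by omega)
    rw [total_incidence_parikh_succ] at h1
    omega
  -- If `j` is too large, `j'` is not before the image of position `i + m + 4`, where the total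
  -- exceeds 3 for all offsets of `m'` and `i'`.
  have hhigh : j ≤ i + m + 3 := by
    by_contra! hj
    have hmem := hb (i + m + 3) (by rw [inWindow_iff, total_configAt]; omega)
    have hs := isSafe_of_mem hsafe hmem
    rw [isSafe, Bool.and_eq_true, total_configAt] at hs
    have hs1 := hs.1
    simp only [Bool.or_eq_true, decide_eq_true_eq, List.all_eq_true] at hs1
    have hs2 := (hs1.resolve_left (by push_cast; omega)) x hx.1 y hy.1
    simp only [configAt, incidence_add, incidence_sub, total_sub, total_add] at hs2
    have h1 := total_incidence_parikh_mono (show i + m + 3 + 1 ≤ j by omega)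
    rw [total_incidence_parikh_succ] at h1
    omega
  have hmem := hb j (by rw [inWindow_iff, total_configAt]; omega)
  have hchild : configAt m' i' j' ∈ children x.2 (configAt m i j) :=
    mem_children.mpr ⟨y, hy.1, z, hz.1, hconf, hj'⟩
  have hbit : (PWord.combine (table x.2) b).testBit (code (configAt m' i' j')) = true :=
    (testBit_combine_table _ _ _).mpr ⟨_, hmem, _, hchild, rfl⟩
  -- A set bit alone does not give membership in `configs`, since large vectors share the code 1620.
  -- As the bit also lies in `mask configs`, the code is a valid one and injectivity applies.
  refine ⟨?_, hbit⟩
  have hbit' : (mask configs).testBit (code (configAt m' i' j')) = true := by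
    rw [← hnext, Nat.testBit_or, hbit, Bool.true_or]
  obtain ⟨v, hv, hcode⟩ := (testBit_mask _ _).mp hbit'
  rwa [← code_injective hcode (code_lt_of_mem_configs hfull hv)]

/-- The state of the word at position `m`. -/
structure IsStateAt (m : ℕ) (s : State) : Prop where
  letter : p m = s.1
  sound : IsSoundAt m s.2
  complete : ∀ i, IsCompleteAt m i s.2

theorem IsStateAt.next {m m' : ℕ} {s : State} {x : Fin 3 × Vec} (hfull : mask configs < 2 ^ 1620)
    (hs : IsStateAt m s) (hclosed : isClosedState tables s = true) (hx : IsImage m m' x)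
    (hnext : isClosedState tables (x.1, combine (table x.2) s.2) = true) :
    IsStateAt m' (x.1, combine (table x.2) s.2) where
  letter := hx.2.1
  sound := hs.sound.combine hfull hx
  complete i' := by
    obtain ⟨i, y, hy⟩ := exists_isImage i'
    refine (hs.complete i).combine hfull ?_ ((isClosedState_iff _ _).mp hnext).1 hx hy
    rw [hs.letter]
    exact ((isClosedState_iff _ _).mp hclosed).2

/-! ### The state at position 0. -/

theorem isImage_zero : IsImage 0 0 (0, (0, 0, 0)) :=
  ⟨by decide, rfl, rfl⟩

theorem isImage_one : IsImage 0 1 (1, (1, 0, 0)) :=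
  ⟨by decide, rfl, rfl⟩

theorem zero_tables : tables.zero = table (0, 0, 0) := rfl

theorem isSoundAt_iterateZero (hfull : mask configs < 2 ^ 1620) (n b : ℕ) (hb : IsSoundAt 0 b) :
    IsSoundAt 0 (iterateZero tables n b) := by
  induction n generalizing b with
  | zero => exact hb
  | succ n ih =>
    rw [iterateZero, force_eq, zero_tables]
    exact ih _ (hb.combine (x := (0, (0, 0, 0))) hfull isImage_zero)

theorem isSoundAt_initialSet (hfull : mask configs < 2 ^ 1620) :
    IsSoundAt 0 (initialSet tables) := by
  refine isSoundAt_iterateZero hfull _ _ fun t ht => ⟨0, 0, ?_⟩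
  have h1 := ht.2
  rw [Nat.testBit_two_pow, decide_eq_true_eq] at h1
  exact (code_injective h1 (by rw [h1]; exact code_lt_of_mem_configs hfull ht.1)).symm

/-- Here parent and child position are both 0, so induction on `m` is unavailable. Completeness goes
by strong induction on `i`: a positive `i` lies in the image of a smaller position, and the set is
fixed by the transition. For `i = 0` the window leaves only `j ≤ 3`, which are the four listed
configurations. -/
theorem isStateAt_zero (hfull : mask configs < 2 ^ 1620)
    (hfix : combine tables.zero (initialSet tables) = initialSet tables)
    (hclosed : isClosedState tables (0, initialSet tables) = true)
    (hmem : ∀ t ∈ ([(0, 0, 0, 0, 0), (0, 1, 1, 0, 0), (0, 2, 1, 1, 0), (0, 1, 1, 1, 1)] :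
      List Config), (initialSet tables).testBit (code t) = true) :
    IsStateAt 0 (0, initialSet tables) where
  letter := rfl
  sound := isSoundAt_initialSet hfull
  complete i := by
    have hcl := (isClosedState_iff _ _).mp hclosed
    induction i using Nat.strong_induction_on with
    | _ i ih =>
      rcases i.eq_zero_or_pos with rfl | hi
      · intro j hj
        rw [inWindow_iff, total_configAt] at hj
        have hbit : (initialSet tables).testBit (code (configAt 0 0 j)) = true := by
          apply hmem
          have : j ≤ 3 := by omega
          interval_cases j <;> decide
        refine ⟨?_, hbit⟩
        have hbit' : (mask configs).testBit (code (configAt 0 0 j)) = true := by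
          rw [← hcl.1, Nat.testBit_or, hbit, Bool.true_or]
        obtain ⟨v, hv, hcode⟩ := (testBit_mask _ _).mp hbit'
        rwa [← code_injective hcode (code_lt_of_mem_configs hfull hv)]
      · obtain ⟨n, y, hy⟩ := exists_isImage i
        rw [zero_tables] at hfix
        have := (ih n (hy.lt_of_pos hi)).combine hfull hcl.2
          (by rw [hfix]; exact hcl.1) isImage_zero hy
        rwa [hfix] at this

/-! ### Correctness of the search. -/

/-- No ordering of the tree is required: insertion and lookup branch by the same comparisons. -/
theorem SearchTree.mem_insert (k m : ℕ) (t : SearchTree) :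
    (t.insert m).mem k = true ↔ k = m ∨ t.mem k = true := by
  induction t with
  | leaf =>
    cases hk : Nat.beq k m <;> simp [insert, mem, hk, ← Nat.beq_eq]
  | node l n r ihl ihr =>
    cases h1 : Nat.beq k n <;> cases h2 : Nat.ble m n <;> cases h3 : Nat.ble k n <;>
      simp only [insert, mem, h1, h2, h3, cond_true, cond_false, ihl, ihr, or_true] <;>
      (refine ⟨Or.inr, fun hk => hk.resolve_left ?_⟩; rintro rfl; simp_all)

/-- The number under which a state is kept in a search tree. -/
def stateKey (s : State) : ℕ := 3 * s.2 + s.1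

theorem stateKey_injective : Function.Injective stateKey := by
  rintro ⟨⟨a, ha⟩, b⟩ ⟨⟨a', ha'⟩, b'⟩ hs
  simp only [stateKey] at hs
  simp only [Prod.mk.injEq, Fin.mk.injEq]
  omega

/-- The invariant of depth-first search: successors of a seen state are seen or still on the list.
When the list is empty the seen states are closed under successors. Running out of fuel gives
`false`, so the size of the bound is immaterial. -/
theorem explore_spec (T : Tables) (n : ℕ) (todo : List State) (seen : SearchTree)
    (hexp : explore T n todo seen = true)
    (hseen : ∀ s, seen.mem (stateKey s) = true → isGoodState T s = true ∧
      ∀ t ∈ successors T s, seen.mem (stateKey t) = true ∨ t ∈ todo) :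
    ∃ R : Set State, (∀ s, seen.mem (stateKey s) = true → s ∈ R) ∧ (∀ s ∈ todo, s ∈ R) ∧
      ∀ s ∈ R, isGoodState T s = true ∧ ∀ t ∈ successors T s, t ∈ R := by
  induction n generalizing todo seen with
  | zero => exact absurd hexp Bool.false_ne_true
  | succ n ih =>
    match todo with
    | [] => exact ⟨{s | seen.mem (stateKey s) = true}, fun s hs => hs, by simp,
        fun s hs => ⟨(hseen s hs).1, fun t ht => by simpa using (hseen s hs).2 t ht⟩⟩
    | (c, b) :: todo =>
      rw [explore, force_eq, force_eq] at hexp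
      have hkey : 3 * b + c.val = stateKey (c, b) := rfl
      rw [hkey] at hexp
      cases hmem : seen.mem (stateKey (c, b)) with
      | true =>
        rw [hmem, cond_true] at hexp
        obtain ⟨R, h1, h2, h3⟩ := ih todo seen hexp fun s hs => ⟨(hseen s hs).1, fun t ht => by
          rcases (hseen s hs).2 t ht with h4 | h4
          · exact Or.inl h4
          · rcases List.mem_cons.mp h4 with rfl | h4
            · exact Or.inl hmem
            · exact Or.inr h4⟩
        exact ⟨R, h1, fun s hs => (List.mem_cons.mp hs).elim (fun h4 => h4 ▸ h1 _ hmem) (h2 s), h3⟩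
      | false =>
        rw [hmem, cond_false] at hexp
        cases hgood : isGoodState T (c, b) with
        | false => rw [hgood, cond_false] at hexp; exact absurd hexp Bool.false_ne_true
        | true =>
          rw [hgood, cond_true] at hexp
          obtain ⟨R, h1, h2, h3⟩ := ih _ _ hexp fun s hs => by
            rcases (SearchTree.mem_insert _ _ _).mp hs with h4 | h4
            · obtain rfl := stateKey_injective h4
              exact ⟨hgood, fun t ht => Or.inr (List.mem_append_left _ ht)⟩
            · refine ⟨(hseen s h4).1, fun t ht => ?_⟩
              rcases (hseen s h4).2 t ht with h5 | h5
              · exact Or.inl ((SearchTree.mem_insert _ _ _).mpr (Or.inr h5))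
              · rcases List.mem_cons.mp h5 with rfl | h5
                · exact Or.inl ((SearchTree.mem_insert _ _ _).mpr (Or.inl rfl))
                · exact Or.inr (List.mem_append_right _ h5)
          refine ⟨R, fun s hs => h1 s ((SearchTree.mem_insert _ _ _).mpr (Or.inr hs)),
            fun s hs => ?_, h3⟩
          rcases List.mem_cons.mp hs with rfl | hs
          · exact h1 _ ((SearchTree.mem_insert _ _ _).mpr (Or.inl rfl))
          · exact h2 s (List.mem_append_right _ hs)

/-! ### Abelian complexity as a count of balanced vectors. -/

/-- The numbers of occurrences of the letters. -/
def countVec (s : Multiset (Fin 3)) : Vec := (s.count 0, s.count 1, s.count 2)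

theorem countVec_injective : Function.Injective countVec := by
  intro s t hst
  simp only [countVec, Prod.mk.injEq, Nat.cast_inj] at hst
  ext a
  fin_cases a
  exacts [hst.1, hst.2.1, hst.2.2]

theorem countVec_factorAt (i n : ℕ) :
    countVec (factorAt p i n : List (Fin 3)) = parikh (i + n) - parikh i := by
  induction n with
  | zero => simp [factorAt, countVec]
  | succ n ih =>
    have h1 : factorAt p i (n + 1) = factorAt p i n ++ [p (i + n)] := by
      simp [factorAt, List.range_succ]
    have h2 : ∀ a, unit a = countVec {a} := by
      intro a; fin_cases a <;> rfl
    have h3 : ∀ s t, countVec (s + t) = countVec s + countVec t := by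
      intro s t; simp [countVec]
    rw [h1, ← Multiset.coe_add, h3, ih, ← Nat.add_assoc, parikh, h2]
    rw [Multiset.coe_singleton]
    abel

/-- Multisets are determined by their letter counts, and translation by `parikh n` does not change
the number of vectors; it turns them into the vectors of balanced configurations at `n`. -/
theorem abelianComplexity_p (n : ℕ) :
    abelianComplexity p n = {v | ∃ i, v = parikh (i + n) - parikh i - parikh n}.ncard := by
  have hinj : Function.Injective fun s => countVec s - parikh n := fun s t hst =>
    countVec_injective (sub_left_injective hst)
  rw [abelianComplexity, ← Set.ncard_image_of_injective _ hinj]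
  congr 1
  ext v
  simp only [factors, Set.mem_image, Set.mem_ofPred_eq]
  constructor
  · rintro ⟨_, ⟨_, ⟨i, rfl⟩, rfl⟩, rfl⟩
    exact ⟨i, by rw [countVec_factorAt]⟩
  · rintro ⟨i, rfl⟩
    exact ⟨_, ⟨_, ⟨i, rfl⟩, rfl⟩, by rw [countVec_factorAt]⟩

theorem numBalanced_tables (b : ℕ) : numBalanced tables b =
    {v | total v = 0 ∧ ∃ t ∈ configsOf b, t.2.2 = v}.ncard := by
  have h1 : numBalanced tables b = (balancedVecs.filter fun v =>
      !Nat.beq (b &&& mask (configs.filter fun t => decide (t.2.2 = v))) 0).length := by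
    rw [← List.countP_eq_length_filter]
    exact List.countP_map
  have h2 : (balancedVecs.filter fun v =>
      !Nat.beq (b &&& mask (configs.filter fun t => decide (t.2.2 = v))) 0).Nodup :=
    (List.nodup_dedup _).filter _
  rw [h1, ← List.toFinset_card_of_nodup h2, ← Set.ncard_coe_finset]
  congr 1
  ext v
  have h3 : (!Nat.beq (b &&& mask (configs.filter fun t => decide (t.2.2 = v))) 0) = true ↔
      ∃ t ∈ configsOf b, t.2.2 = v := by
    rw [Bool.not_eq_true', ← Bool.not_eq_true, Nat.beq_eq, ← ne_eq, land_ne_zero]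
    simp only [testBit_mask, List.mem_filter, decide_eq_true_eq]
    constructor
    · rintro ⟨_, hb, t, ⟨ht, hv⟩, rfl⟩
      exact ⟨t, ⟨ht, hb⟩, hv⟩
    · rintro ⟨t, ⟨ht, hb⟩, hv⟩
      exact ⟨_, hb, t, ⟨ht, hv⟩, rfl⟩
  rw [Finset.mem_coe, List.mem_toFinset, List.mem_filter, h3, Set.mem_ofPred_eq]
  refine and_congr_left fun ⟨t, ht, hv⟩ => ?_
  simp only [balancedVecs, List.mem_dedup, List.mem_filter, List.mem_map, decide_eq_true_eq]
  exact ⟨fun h4 => h4.2, fun h4 => ⟨⟨t, ht.1, hv⟩, h4⟩⟩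

theorem IsStateAt.abelianComplexity_eq {n : ℕ} {s : State} (hs : IsStateAt n s) :
    abelianComplexity p n = numBalanced tables s.2 := by
  rw [abelianComplexity_p, numBalanced_tables]
  congr 1
  ext v
  simp only [Set.mem_ofPred_eq]
  constructor
  · rintro ⟨i, rfl⟩
    have h1 : total (configAt n i (i + n)).2.2 = 0 := by
      rw [total_configAt]; push_cast; ring
    exact ⟨h1, _, hs.complete i (i + n) (by rw [inWindow_iff, h1]; decide), rfl⟩
  · rintro ⟨h1, t, ht, rfl⟩
    obtain ⟨i, j, rfl⟩ := hs.sound t ht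
    rw [total_configAt] at h1
    obtain rfl : j = i + n := by omega
    exact ⟨i, rfl⟩

/-! ### States at all positive positions and recurrence. -/

/-- The set `R` contains the states at all positive positions, and `R` is closed under passing to
successors. -/
structure IsInvariant (R : Set State) : Prop where
  full : mask configs < 2 ^ 1620
  initial_mem : initialState tables ∈ R
  initial : IsStateAt 1 (initialState tables)
  good : ∀ s ∈ R, isGoodState tables s = true
  successors_mem : ∀ s ∈ R, ∀ t ∈ successors tables s, t ∈ R

theorem isClosedState_of_isGoodState {s : State} (hs : isGoodState tables s = true) :
    isClosedState tables s = true := by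
  rw [isGoodState, Bool.and_eq_true] at hs
  exact hs.1

theorem IsInvariant.next {R : Set State} (hR : IsInvariant R) {m m' : ℕ} {s : State}
    {x : Fin 3 × Vec} (hsR : s ∈ R) (hs : IsStateAt m s) (hx : IsImage m m' x) :
    (x.1, combine (table x.2) s.2) ∈ R ∧ IsStateAt m' (x.1, combine (table x.2) s.2) := by
  have hmem : (x.1, combine (table x.2) s.2) ∈ R := by
    refine hR.successors_mem s hsR _ ?_
    rw [successors_tables, ← hs.letter]
    exact List.mem_map.mpr ⟨x, hx.1, rfl⟩
  exact ⟨hmem, hs.next hR.full (isClosedState_of_isGoodState (hR.good _ hsR)) hx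
    (isClosedState_of_isGoodState (hR.good _ hmem))⟩

theorem IsInvariant.exists_state {R : Set State} (hR : IsInvariant R) (m : ℕ) (hm : 1 ≤ m) :
    ∃ s ∈ R, IsStateAt m s := by
  induction m using Nat.strong_induction_on with
  | _ m ih =>
    obtain ⟨n, x, hx⟩ := exists_isImage m
    rcases n.eq_zero_or_pos with rfl | hn
    -- The image of the letter at position 0 has length two, so its only positive position is 1.
    · have h1 := congrArg total hx.2.2
      have h2 := total_lt_of_mem hx.1
      rw [total_parikh, total_add] at h1
      have h3 : total (incidence (parikh 0)) = 0 := rfl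
      have h4 : total (incidence (unit (p 0))) = 2 := rfl
      obtain rfl : m = 1 := by omega
      exact ⟨_, hR.initial_mem, hR.initial⟩
    · obtain ⟨s, hsR, hs⟩ := ih n (hx.lt hn) hn
      obtain ⟨h1, h2⟩ := hR.next hsR hs hx
      exact ⟨_, h1, h2⟩

theorem IsInvariant.run {R : Set State} (hR : IsInvariant R) (u : List ℕ) {m : ℕ} (hm : 1 ≤ m)
    {s t : State} (hsR : s ∈ R) (hs : IsStateAt m s) (hrun : run tables u s = some t) :
    t ∈ R ∧ ∃ n, m + u.length ≤ n ∧ IsStateAt n t := by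
  induction u generalizing m s with
  | nil =>
    obtain rfl : s = t := Option.some.inj hrun
    exact ⟨hsR, m, le_rfl, hs⟩
  | cons k u ih =>
    rw [PWord.run, force_eq] at hrun
    obtain ⟨s', hs', hrun⟩ := Option.bind_eq_some_iff.mp hrun
    have hmem := List.mem_of_getElem? hs'
    rw [successors_tables, List.mem_map] at hmem
    obtain ⟨x, hx, rfl⟩ := hmem
    simp only at hx
    rw [← hs.letter] at hx
    obtain ⟨n, hn⟩ := exists_isImage_of_mem hx
    obtain ⟨h1, h2⟩ := hR.next hsR hs hn
    obtain ⟨h3, l, hl, h4⟩ := ih (hm.trans (hn.lt hm).le) h1 h2 hrun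
    have := hn.lt hm
    exact ⟨h3, l, by rw [List.length_cons]; omega, h4⟩

theorem IsInvariant.infinite {R : Set State} (hR : IsInvariant R) {k : ℕ} {u w : List ℕ}
    (hw : 0 < w.length) (hrec : isRecurrent tables k u w = true) :
    {n : ℕ | 1 ≤ n ∧ abelianComplexity p n = k}.Infinite := by
  rw [isRecurrent] at hrec
  split at hrec
  · exact absurd hrec Bool.false_ne_true
  · rename_i c b hu
    simp only [force_eq, Bool.and_eq_true, Nat.beq_eq] at hrec
    obtain ⟨hk, hrec⟩ := hrec
    split at hrec
    · exact absurd hrec Bool.false_ne_true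
    · rename_i d b' hcycle
      simp only [Bool.and_eq_true, decide_eq_true_eq, Nat.beq_eq] at hrec
      obtain ⟨rfl, rfl⟩ := hrec
      obtain ⟨hmem, n₀, hn₀, hs₀⟩ := hR.run u le_rfl hR.initial_mem hR.initial hu
      -- Every step of a path moves to a strictly larger position, so each turn around the nonempty
      -- cycle `w` reaches the same state further out.
      have key : ∀ N, ∃ n, N ≤ n ∧ 1 ≤ n ∧ IsStateAt n (c, b) := by
        intro N
        induction N with
        | zero => exact ⟨n₀, Nat.zero_le _, by omega, hs₀⟩
        | succ N ih =>
          obtain ⟨n, hn, hn1, hs⟩ := ih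
          obtain ⟨-, n', hn', hs'⟩ := hR.run w hn1 hmem hs hcycle
          exact ⟨n', by omega, by omega, hs'⟩
      refine Set.infinite_of_forall_exists_gt fun N => ?_
      obtain ⟨n, hn, hn1, hs⟩ := key (N + 1)
      exact ⟨n, ⟨hn1, hs.abelianComplexity_eq.trans hk⟩, hn⟩

end PWord

open PWord in
theorem corollary5 :
    (∀ n : ℕ, 1 ≤ n → PWord.abelianComplexity PWord.p n ∈ ({3, 4, 5, 6, 7} : Set ℕ)) ∧
    ∀ k ∈ ({3, 4, 5, 6, 7} : Set ℕ),
      {n : ℕ | 1 ≤ n ∧ PWord.abelianComplexity PWord.p n = k}.Infinite := by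
  have hv := verify_tables
  rw [Tables.force_eq, verify] at hv
  simp only [force_eq, Bool.and_eq_true, Nat.beq_eq, List.all_eq_true] at hv
  obtain ⟨⟨⟨⟨⟨⟨⟨hfull, ⟨hfix, hclosed⟩, hmem⟩, hexp⟩, h3⟩, h4⟩, h5⟩, h6⟩, h7⟩ := hv
  have hfull : mask configs < 2 ^ 1620 := Nat.le_of_ble_eq_true hfull
  have hzero := isStateAt_zero hfull hfix hclosed hmem
  -- The search starts at position 1 with nothing seen. Position 0 is left out because the
  -- complexity at 0 is 1, which `isGoodState` rejects.
  obtain ⟨R, -, hR, hgood⟩ := explore_spec _ _ _ _ hexp fun s hs =>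
    absurd hs Bool.false_ne_true
  have hinit := hR _ (List.mem_singleton_self _)
  have hinv : IsInvariant R :=
    { full := hfull
      initial_mem := hinit
      initial := hzero.next (x := (1, (1, 0, 0))) hfull hclosed isImage_one
        (isClosedState_of_isGoodState (hgood _ hinit).1)
      good := fun s hs => (hgood s hs).1
      successors_mem := fun s hs => (hgood s hs).2 }
  constructor
  · intro n hn
    obtain ⟨s, hsR, hs⟩ := hinv.exists_state n hn
    have h1 := hinv.good s hsR
    simp only [isGoodState, force_eq, Bool.and_eq_true, Nat.ble_eq] at h1
    rw [hs.abelianComplexity_eq]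
    simp only [Set.mem_insert_iff, Set.mem_singleton_iff]
    omega
  · rintro k (rfl | rfl | rfl | rfl | rfl)
    exacts [hinv.infinite (by decide) h3, hinv.infinite (by decide) h4,
      hinv.infinite (by decide) h5, hinv.infinite (by decide) h6, hinv.infinite (by decide) h7]
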